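/- Let $\mathcal G$ be a connected metric graph without internal edges ($\mathcal I=\emptyset$), that is, finitely many half-lines $[0,\infty)$, indexed by a finite set $\mathcal E$ of external edges and starting at one common vertex. Let $\mathcal H=\bigoplus_{e\in\mathcal E}L^2([0,\infty))$ (complex-valued functions), $\mathcal K=\mathbb C^{\mathcal E}$, and equip $\mathcal K\oplus\mathcal K$ with the Hermitian symplectic form $\omega(x,y)=\langle x_1,y_2\rangle-\langle x_2,y_1\rangle$. A subspace of $\mathcal K\oplus\mathcal K$ is isotropic if $\omega$ vanishes on it identically, and maximal isotropic if, in addition, it is not a proper subspace of a larger isotropic subspace. For a maximal isotropic subspace $\mathcal M\subset\mathcal K\oplus\mathcal K$ let $\Delta(\mathcal M)$ be the (self-adjoint) Laplace operator in $\mathcal H$ acting by $(\Delta(\mathcal M)\psi)_e=\psi_e''$ on the domain of all $\psi=\{\psi_e\}_{e\in\mathcal E}\in\mathcal H$ such that $\psi_e$ and $\psi_e'$ are absolutely continuous (on every bounded interval $[0,b]$), $\psi_e''\in L^2([0,\infty))$ for all $e$, and $\bigl(\{\psi_e(0)\}_{e},\{\psi_e'(0)\}_{e}\bigr)\in\mathcal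 M$. Write $\mathcal M=\{(\chi_1,\chi_2)\mid A\chi_1+B\chi_2=0\}$ with $\mathcal E\times\mathcal E$ matrices $A,B$, and set $\mathfrak S(\mathsf k;\mathcal M)=-(A+\mathrm i\mathsf kB)^{-1}(A-\mathrm i\mathsf kB)$ whenever $A+\mathrm i\mathsf kB$ is invertible; this does not depend on the choice of $(A,B)$. Call $\mathcal M$ strictly positive if there is a $\varkappa_0\ge 0$ such that for all $\varkappa\ge\varkappa_0$ the matrix $\mathfrak S(\mathrm i\varkappa;\mathcal M)$ exists and all entries of $\mathbb I+\mathfrak S(\mathrm i\varkappa;\mathcal M)$ are (real and) positive. **Proposition.** Assume that $\mathcal I=\emptyset$ and that the maximal isotropic subspace $\mathcal M$ is strictly positive. If $-\Delta(\mathcal M)$ has an eigenvalue, then it has a smallest eigenvalue $\lambda$; moreover $\lambda\le 0$, and $\lambda$ is simple, i.e. its eigenspace $\{\psi\in\mathrm{Dom}\,\Delta(\mathcal M)\mid-\Delta(\mathcal M)\psi=\lambda\psi\}$ is one-dimensional. -/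

import Mathlib

noncomputable section

open MeasureTheory Set

/-! A connected metric graph without internal edges consists of finitely many half-lines
`[0, ∞)`, indexed by the finite set `E` of (external) edges, all starting at a single vertex. -/

namespace StarGraph

/-- Lebesgue measure on the half-line `[0, ∞)`. -/
abbrev halfLine : Measure ℝ := volume.restrict (Ici (0 : ℝ))

/-- The Hilbert space `⨁_{e ∈ E} L²([0, ∞))` of the graph (complex valued functions). -/
abbrev HilbertSpace (E : Type*) [Fintype E] : Type _ :=
  PiLp 2 (fun _ : E => Lp ℂ 2 halfLine)

/-- The double `𝒦 ⊕ 𝒦` of the space `𝒦 = ℂ^E` of boundary values. -/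
abbrev BoundarySpace (E : Type*) : Type _ := (E → ℂ) × (E → ℂ)

section Boundary

variable {E : Type*} [Fintype E]

/-- The Hermitian symplectic form `ω(x, y) = ⟨x, J y⟩`, where `J (y₁, y₂) = (y₂, -y₁)` and the
scalar product is conjugate linear in its first argument. -/
def omega (x y : BoundarySpace E) : ℂ := star x.1 ⬝ᵥ y.2 - star x.2 ⬝ᵥ y.1

/-- A subspace is isotropic if the symplectic form vanishes on it. -/
def IsIsotropic (M : Submodule ℂ (BoundarySpace E)) : Prop :=
  ∀ x ∈ M, ∀ y ∈ M, omega x y = 0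

/-- A maximal isotropic subspace: isotropic, and not properly contained in an isotropic one. -/
def IsMaximalIsotropic (M : Submodule ℂ (BoundarySpace E)) : Prop :=
  Maximal IsIsotropic M

/-- The subspace `M(A, B) = Ker (A, B) = {(χ₁, χ₂) | A χ₁ + B χ₂ = 0}`. -/
def kerSubspace (A B : Matrix E E ℂ) : Submodule ℂ (BoundarySpace E) :=
  LinearMap.ker (A.mulVecLin.coprod B.mulVecLin)

/-- `S` is the matrix `𝔖(k; M) = -(A + i k B)⁻¹ (A - i k B)`, where `M = M(A, B)` and `A + i k B`
is invertible. For a maximal isotropic `M` there is at most one such `S`: it does not depend on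
the choice of `(A, B)`. -/
def IsScatteringMatrix [DecidableEq E] (k : ℂ) (M : Submodule ℂ (BoundarySpace E))
    (S : Matrix E E ℂ) : Prop :=
  ∃ A B : Matrix E E ℂ, kerSubspace A B = M ∧ IsUnit (A + (Complex.I * k) • B) ∧
    S = -((A + (Complex.I * k) • B)⁻¹ * (A - (Complex.I * k) • B))

/-- All entries of the complex matrix `C` are (real and) positive: `C ≻ 0`. -/
def EntrywisePositive (C : Matrix E E ℂ) : Prop :=
  ∀ e e', 0 < (C e e').re ∧ (C e e').im = 0

/-- `M` is strictly positive: for some `κ₀ ≥ 0`, the matrix `𝔖(iκ; M)` exists and satisfies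
`1 + 𝔖(iκ; M) ≻ 0` for all `κ ≥ κ₀`. -/
def IsStrictlyPositiveSubspace [DecidableEq E] (M : Submodule ℂ (BoundarySpace E)) : Prop :=
  ∃ κ₀ : ℝ, 0 ≤ κ₀ ∧ ∀ κ : ℝ, κ₀ ≤ κ →
    ∃ S : Matrix E E ℂ, IsScatteringMatrix (Complex.I * κ) M S ∧ EntrywisePositive (1 + S)

end Boundary

/-- `f : [0, ∞) → ℂ` is square integrable, `f` and its derivative `f'` are absolutely continuous
(on every `[0, b]`), and `f''`, the almost everywhere defined derivative of `f'`, is square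
integrable. Only the values on `[0, ∞)` matter. -/
structure IsMaximalDomainFunction (f f' f'' : ℝ → ℂ) : Prop where
  memLp : MemLp f 2 halfLine
  ac : ∀ b : ℝ, 0 ≤ b → AbsolutelyContinuousOnInterval f 0 b
  hasDeriv : ∀ x : ℝ, 0 ≤ x → HasDerivWithinAt f (f' x) (Ici 0) x
  ac_deriv : ∀ b : ℝ, 0 ≤ b → AbsolutelyContinuousOnInterval f' 0 b
  hasDeriv_deriv : ∀ᵐ x ∂halfLine, HasDerivAt f' (f'' x) x
  memLp_deriv_deriv : MemLp f'' 2 halfLine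

theorem IsMaximalDomainFunction.zero :
    IsMaximalDomainFunction (fun _ => 0) (fun _ => 0) (fun _ => 0) where
  memLp := MemLp.zero'
  ac b _ := by simpa [AbsolutelyContinuousOnInterval] using tendsto_const_nhds
  hasDeriv x _ := hasDerivWithinAt_const x _ 0
  ac_deriv b _ := by simpa [AbsolutelyContinuousOnInterval] using tendsto_const_nhds
  hasDeriv_deriv := Filter.Eventually.of_forall fun x => hasDerivAt_const x 0
  memLp_deriv_deriv := MemLp.zero'

theorem IsMaximalDomainFunction.add {f f' f'' g g' g'' : ℝ → ℂ}
    (hf : IsMaximalDomainFunction f f' f'') (hg : IsMaximalDomainFunction g g' g'') :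
    IsMaximalDomainFunction (f + g) (f' + g') (f'' + g'') where
  memLp := hf.memLp.add hg.memLp
  ac b hb := (hf.ac b hb).add (hg.ac b hb)
  hasDeriv x hx := (hf.hasDeriv x hx).add (hg.hasDeriv x hx)
  ac_deriv b hb := (hf.ac_deriv b hb).add (hg.ac_deriv b hb)
  hasDeriv_deriv := by
    filter_upwards [hf.hasDeriv_deriv, hg.hasDeriv_deriv] with x h1 h2 using h1.add h2
  memLp_deriv_deriv := hf.memLp_deriv_deriv.add hg.memLp_deriv_deriv

theorem IsMaximalDomainFunction.smul (c : ℂ) {f f' f'' : ℝ → ℂ}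
    (hf : IsMaximalDomainFunction f f' f'') :
    IsMaximalDomainFunction (c • f) (c • f') (c • f'') where
  memLp := hf.memLp.const_smul c
  ac b hb := (hf.ac b hb).const_smul c
  hasDeriv x hx := (hf.hasDeriv x hx).const_smul c
  ac_deriv b hb := (hf.ac_deriv b hb).const_smul c
  hasDeriv_deriv := by
    filter_upwards [hf.hasDeriv_deriv] with x h1 using h1.const_smul c
  memLp_deriv_deriv := hf.memLp_deriv_deriv.const_smul c

/-- If `f` vanishes almost everywhere, then so does its second derivative. -/
theorem IsMaximalDomainFunction.deriv_deriv_ae_zero {f f' f'' : ℝ → ℂ}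
    (hf : IsMaximalDomainFunction f f' f'') (h0 : f =ᵐ[halfLine] 0) : f'' =ᵐ[halfLine] 0 := by
  have hcont : ContinuousOn f (Ioi 0) := fun x hx =>
    ((hf.hasDeriv x (le_of_lt hx)).continuousWithinAt).mono Ioi_subset_Ici_self
  have hzero : ∀ x ∈ Ioi (0 : ℝ), f x = 0 := by
    have h1 : f =ᵐ[volume.restrict (Ioi (0 : ℝ))] 0 :=
      ae_restrict_of_ae_restrict_of_subset Ioi_subset_Ici_self h0
    exact Measure.eqOn_open_of_ae_eq h1 isOpen_Ioi hcont continuousOn_const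
  have hderiv : ∀ x ∈ Ioi (0 : ℝ), f' x = 0 := by
    intro x hx
    have h1 : HasDerivAt f (f' x) x :=
      (hf.hasDeriv x (le_of_lt hx)).hasDerivAt (Ici_mem_nhds hx)
    have h2 : HasDerivAt f 0 x :=
      (hasDerivAt_const x (0 : ℂ)).congr_of_eventuallyEq
        (Filter.eventually_of_mem (Ioi_mem_nhds hx) hzero)
    exact h1.unique h2
  have hpos : ∀ᵐ x ∂halfLine, x ∈ Ioi (0 : ℝ) := by
    rw [halfLine, ← restrict_Ioi_eq_restrict_Ici]
    exact ae_restrict_mem measurableSet_Ioi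
  filter_upwards [hf.hasDeriv_deriv, hpos] with x h1 hx
  have h2 : HasDerivAt f' 0 x :=
    (hasDerivAt_const x (0 : ℂ)).congr_of_eventuallyEq
      (Filter.eventually_of_mem (Ioi_mem_nhds hx) hderiv)
  exact h1.unique h2

section Laplacian

variable {E : Type*} [Fintype E]

/-- The graph of `Δ(M)`: the pairs `(ψ, ψ'')` where every component `ψ_e` and its derivative are
absolutely continuous with square integrable second derivative, and where the boundary values
`[ψ] = ({ψ_e(0)}, {ψ_e'(0)})` belong to `M`. -/
def laplacianGraph (M : Submodule ℂ (BoundarySpace E)) :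
    Submodule ℂ (HilbertSpace E × HilbertSpace E) where
  carrier := {p | ∃ f f' f'' : E → ℝ → ℂ,
    (∀ e, IsMaximalDomainFunction (f e) (f' e) (f'' e)) ∧
    (∀ e, p.1 e =ᵐ[halfLine] f e) ∧ (∀ e, p.2 e =ᵐ[halfLine] f'' e) ∧
    ((fun e => f e 0, fun e => f' e 0) : BoundarySpace E) ∈ M}
  zero_mem' := by
    refine ⟨fun _ _ => 0, fun _ _ => 0, fun _ _ => 0, fun _ => .zero, fun e => ?_, fun e => ?_,
      M.zero_mem⟩
    · exact Lp.coeFn_zero _ _ _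
    · exact Lp.coeFn_zero _ _ _
  add_mem' := by
    rintro p q ⟨f, f', f'', hf, hf1, hf2, hfM⟩ ⟨g, g', g'', hg, hg1, hg2, hgM⟩
    refine ⟨f + g, f' + g', f'' + g'', fun e => (hf e).add (hg e), fun e => ?_, fun e => ?_,
      M.add_mem hfM hgM⟩
    · exact (Lp.coeFn_add _ _).trans ((hf1 e).add (hg1 e))
    · exact (Lp.coeFn_add _ _).trans ((hf2 e).add (hg2 e))
  smul_mem' := by
    rintro c p ⟨f, f', f'', hf, hf1, hf2, hfM⟩
    refine ⟨c • f, c • f', c • f'', fun e => (hf e).smul c, fun e => ?_, fun e => ?_,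
      M.smul_mem c hfM⟩
    · exact (Lp.coeFn_smul _ _).trans ((hf1 e).const_smul c)
    · exact (Lp.coeFn_smul _ _).trans ((hf2 e).const_smul c)

/-- The Laplace operator `Δ(M)`: the unbounded operator in `⨁_e L²([0, ∞))` with domain
`{ψ ∈ 𝒟 | [ψ] ∈ M}`, acting as `(Δ(M) ψ)_e = ψ_e''`. -/
def laplacian (M : Submodule ℂ (BoundarySpace E)) : HilbertSpace E →ₗ.[ℂ] HilbertSpace E :=
  (laplacianGraph M).toLinearPMap

theorem graph_laplacian (M : Submodule ℂ (BoundarySpace E)) :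
    (laplacian M).graph = laplacianGraph M := by
  refine Submodule.toLinearPMap_graph_eq _ ?_
  rintro ⟨p, q⟩ ⟨f, f', f'', hf, hf1, hf2, -⟩ hp
  simp only at hp hf1 hf2 ⊢
  subst hp
  ext e : 1
  refine Lp.ext ?_
  have h0 : f e =ᵐ[halfLine] 0 := (hf1 e).symm.trans (Lp.coeFn_zero _ _ _)
  exact (hf2 e).trans (((hf e).deriv_deriv_ae_zero h0).trans (Lp.coeFn_zero _ _ _).symm)

end Laplacian

/-- The eigenspace `{ψ ∈ Dom T | T ψ = z ψ}` of an unbounded operator. -/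
def eigenspace {H : Type*} [AddCommGroup H] [Module ℂ H] (T : H →ₗ.[ℂ] H) (z : ℂ) :
    Submodule ℂ H :=
  (LinearMap.ker (T.toFun - z • T.domain.subtype)).map T.domain.subtype

/-- `z` is an eigenvalue of the unbounded operator `T`. -/
def IsEigenvalue {H : Type*} [AddCommGroup H] [Module ℂ H] (T : H →ₗ.[ℂ] H) (z : ℂ) : Prop :=
  eigenspace T z ≠ ⊥

end StarGraph

end

open MeasureTheory Set

/-! ### Square-integrable solutions of `f'' = κ² f` on the half-line. -/

namespace StarGraph

/-! For `μ ≥ 0` the equation `-f'' = μ f` has no nonzero `L²` solution on a half-line; for `μ =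
-κ²`, `κ > 0`, only the multiples of `e^{-κx}` survive. Hence `-κ²` is an eigenvalue exactly when
some nonzero `(c, -κ c)` lies in `M`, and its eigenspace is the space of such `c`
(`isEigenvalue_neg_laplacian_iff`, `mem_eigenspace_neg_laplacian_iff_of_pos`).

Fix `K > 0` with `K ≥ κ₀` and put `R = (2K)⁻¹ (1 + 𝔖(iK; M))`. Then `M` is given by `χ₁ = R (χ₂ + K
χ₁)`, so `(c, -κ c) ∈ M` means `c = (K - κ) R c`. Existence of `𝔖(iκ; M)` for `κ ≥ κ₀` forces `κ <
K`, so `c` is an eigenvector of `R` for `1/(K - κ)`, which increases with `κ`: the lowest eigenvalue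
of `-Δ(M)` comes from the top eigenvalue of `R`. Isotropy makes `R` Hermitian and strict positivity
makes its entries positive, so its top eigenvalue is simple by Perron–Frobenius
(`exists_isGreatest_boundary`). -/

theorem memLp_halfLine_comp_add {f : ℝ → ℂ} (hf : MemLp f 2 halfLine) {h : ℝ} (hh : 0 ≤ h) :
    MemLp (fun x => f (x + h)) 2 halfLine := by
  have h1 : MemLp f 2 (volume.restrict (Ici h)) :=
    hf.mono_measure (Measure.restrict_mono (Ici_subset_Ici.2 hh) le_rfl)
  have h2 := (measurePreserving_add_right (volume : Measure ℝ) h).restrict_preimage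
    (measurableSet_Ici (a := h))
  have h3 : (fun x : ℝ => x + h) ⁻¹' Ici h = Ici 0 := by ext x; simp
  rw [h3] at h2
  exact h1.comp_measurePreserving h2

/-- The half-line has infinite measure, so no nonzero constant is in `L²`. Every coefficient of a
non-decaying solution is eliminated this way. -/
theorem eq_zero_of_memLp_halfLine {g : ℝ → ℂ} (hg : MemLp g 2 halfLine) {c : ℂ}
    (h : ∀ x, 0 ≤ x → ‖c‖ ≤ ‖g x‖) : c = 0 := by
  have h1 : MemLp (fun _ : ℝ => c) 2 halfLine := by
    refine hg.mono aestronglyMeasurable_const ?_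
    filter_upwards [ae_restrict_mem measurableSet_Ici] with x hx using h x hx
  rcases (memLp_const_iff (by norm_num) (by norm_num)).1 h1 with h2 | h2
  · exact h2
  · simp at h2

theorem memLp_exp_neg {κ : ℝ} (hκ : 0 < κ) :
    MemLp (fun x : ℝ => Complex.exp (-κ * x)) 2 halfLine := by
  rw [memLp_two_iff_integrable_sq_norm (by fun_prop)]
  have h1 := exp_neg_integrableOn_Ioi 0 (b := 2 * κ) (by linarith)
  rw [← integrableOn_Ici_iff_integrableOn_Ioi] at h1
  refine h1.congr (Filter.Eventually.of_forall fun x => ?_)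
  simp only [Complex.norm_exp]
  rw [← Real.exp_nat_mul]
  congr 1
  simp
  ring

theorem hasDerivAt_exp_mul (κ : ℂ) (x : ℝ) :
    HasDerivAt (fun x : ℝ => Complex.exp (κ * x)) (κ * Complex.exp (κ * x)) x := by
  have h1 : HasDerivAt (fun x : ℝ => κ * (x : ℂ)) κ x := by
    simpa using (Complex.ofRealCLM.hasDerivAt (x := x)).const_mul κ
  simpa [mul_comm] using h1.cexp

theorem absolutelyContinuousOnInterval_exp_mul (κ : ℂ) (a b : ℝ) :
    AbsolutelyContinuousOnInterval (fun x : ℝ => Complex.exp (κ * x)) a b := by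
  refine ContDiffOn.absolutelyContinuousOnInterval (ContDiff.contDiffOn ?_)
  exact (contDiff_const.mul Complex.ofRealCLM.contDiff).cexp

theorem isMaximalDomainFunction_exp {κ : ℝ} (hκ : 0 < κ) :
    IsMaximalDomainFunction (fun x => Complex.exp (-κ * x)) (fun x => -κ * Complex.exp (-κ * x))
      (fun x => (κ : ℂ) ^ 2 * Complex.exp (-κ * x)) where
  memLp := memLp_exp_neg hκ
  ac b _ := absolutelyContinuousOnInterval_exp_mul _ _ _
  hasDeriv x _ := (hasDerivAt_exp_mul _ x).hasDerivWithinAt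
  ac_deriv b _ := (absolutelyContinuousOnInterval_exp_mul (-κ) 0 b).const_smul (-(κ : ℂ))
  hasDeriv_deriv := Filter.Eventually.of_forall fun x => by
    convert! (hasDerivAt_exp_mul (-κ) x).const_mul (-(κ : ℂ)) using 1
    ring
  memLp_deriv_deriv := (memLp_exp_neg hκ).const_mul _

theorem eq_of_ac_of_ae_hasDerivAt_zero {g : ℝ → ℂ}
    (hg : ∀ b : ℝ, 0 ≤ b → AbsolutelyContinuousOnInterval g 0 b)
    (hg' : ∀ᵐ x ∂halfLine, HasDerivAt g 0 x) {x : ℝ} (hx : 0 ≤ x) : g x = g 0 := by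
  obtain ⟨C, hC⟩ := (hg x hx).const_of_ae_hasDerivAt_zero (by
    rw [ae_restrict_iff' measurableSet_Ici] at hg'
    filter_upwards [hg'] with y hy h
    rw [uIcc_of_le hx] at h
    exact hy h.1)
  rw [hC x right_mem_uIcc, hC 0 left_mem_uIcc]

namespace IsMaximalDomainFunction

variable {f f' f'' : ℝ → ℂ}

theorem ae_hasDerivAt (hf : IsMaximalDomainFunction f f' f'') :
    ∀ᵐ x ∂halfLine, HasDerivAt f (f' x) x := by
  rw [halfLine, ← restrict_Ioi_eq_restrict_Ici]
  filter_upwards [ae_restrict_mem measurableSet_Ioi] with x hx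
  exact (hf.hasDeriv x (le_of_lt hx)).hasDerivAt (Ici_mem_nhds hx)

/-- The first integral `e^{κ x} (f' - κ f)` of the equation `f'' = κ² f`. -/
theorem exp_mul_sub_eq (hf : IsMaximalDomainFunction f f' f'') (κ : ℂ)
    (h : f'' =ᵐ[halfLine] fun x => κ ^ 2 * f x) {x : ℝ} (hx : 0 ≤ x) :
    f' x - κ * f x = Complex.exp (-κ * x) * (f' 0 - κ * f 0) := by
  have key := eq_of_ac_of_ae_hasDerivAt_zero
    (g := fun x => Complex.exp (κ * x) * (f' x - κ * f x)) (fun b hb => ?_) ?_ hx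
  · simp only [Complex.ofReal_zero, mul_zero, Complex.exp_zero, one_mul] at key
    rw [← key, ← mul_assoc, ← Complex.exp_add]
    simp
  · exact (absolutelyContinuousOnInterval_exp_mul κ 0 b).smul
      ((hf.ac_deriv b hb).sub ((hf.ac b hb).const_smul κ))
  · filter_upwards [h, hf.hasDeriv_deriv, hf.ae_hasDerivAt] with y h1 h2 h3
    convert! (hasDerivAt_exp_mul κ y).mul (h2.sub (h3.const_mul κ)) using 1
    rw [h1, Pi.sub_apply]
    ring

/-- Difference of the first integrals for `-κ` and `κ`. It is empty at `κ = 0`, which is why the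
affine case is treated separately. -/
theorem two_mul_eq (hf : IsMaximalDomainFunction f f' f'') (κ : ℂ)
    (h : f'' =ᵐ[halfLine] fun x => κ ^ 2 * f x) {x : ℝ} (hx : 0 ≤ x) :
    2 * κ * f x = Complex.exp (κ * x) * (f' 0 + κ * f 0)
      - Complex.exp (-κ * x) * (f' 0 - κ * f 0) := by
  have h1 := hf.exp_mul_sub_eq κ h hx
  have h2 := hf.exp_mul_sub_eq (-κ) (by simpa using h) hx
  simp only [neg_neg, neg_mul, sub_neg_eq_add] at h1 h2 ⊢
  rw [← h1, ← h2]
  ring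

theorem eq_exp_of_pos (hf : IsMaximalDomainFunction f f' f'') {κ : ℝ} (hκ : 0 < κ)
    (h : f'' =ᵐ[halfLine] fun x => (κ : ℂ) ^ 2 * f x) :
    f' 0 = -κ * f 0 ∧ ∀ x, 0 ≤ x → f x = f 0 * Complex.exp (-κ * x) := by
  have h0 : f' 0 + κ * f 0 = 0 := by
    -- Moving the decaying exponential to the left of `two_mul_eq` shows that `e^{κx} (f' 0 + κ f
    -- 0)` is in `L²`.
    refine eq_zero_of_memLp_halfLine ((hf.memLp.const_mul (2 * (κ : ℂ))).add
      ((memLp_exp_neg hκ).mul_const (f' 0 - κ * f 0))) fun x hx => ?_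
    simp only [Pi.add_apply, hf.two_mul_eq κ h hx, sub_add_cancel, norm_mul, Complex.norm_exp]
    refine le_mul_of_one_le_left (norm_nonneg _) (Real.one_le_exp ?_)
    simpa using mul_nonneg hκ.le hx
  have h1 : f' 0 = -κ * f 0 := by linear_combination h0
  refine ⟨h1, fun x hx => ?_⟩
  have h2 : (2 * κ : ℂ) ≠ 0 := by simpa using hκ.ne'
  refine mul_left_cancel₀ h2 ?_
  rw [hf.two_mul_eq κ h hx, h0, h1]
  ring

/-- A shift by the quarter period `π / (2k)` multiplies the two exponentials by `i` and `-i`.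
Combining `f` with its shift therefore isolates each exponential, whose modulus is constant, so both
coefficients vanish. -/
theorem eq_zero_of_oscillating (hf : IsMaximalDomainFunction f f' f'') {k : ℝ} (hk : 0 < k)
    (h : f'' =ᵐ[halfLine] fun x => -(k : ℂ) ^ 2 * f x) {x : ℝ} (hx : 0 ≤ x) : f x = 0 := by
  set κ : ℂ := Complex.I * k with hκ
  have hκ0 : κ ≠ 0 := by simp [hκ, hk.ne']
  have h' : f'' =ᵐ[halfLine] fun x => κ ^ 2 * f x := by
    simpa [hκ, mul_pow] using h
  set s : ℝ := Real.pi / (2 * k) with hs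
  have hs0 : 0 ≤ s := by positivity
  have hκs : κ * s = Real.pi / 2 * Complex.I := by
    have : (k : ℂ) ≠ 0 := by simp [hk.ne']
    rw [hκ, hs]
    push_cast
    field_simp
  have shift : ∀ x, 0 ≤ x → 2 * κ * f (x + s) = Complex.I *
      (Complex.exp (κ * x) * (f' 0 + κ * f 0) + Complex.exp (-κ * x) * (f' 0 - κ * f 0)) := by
    intro x hx
    rw [hf.two_mul_eq κ h' (add_nonneg hx hs0)]
    have e1 : Complex.exp (κ * ↑(x + s)) = Complex.exp (κ * x) * Complex.I := by
      rw [Complex.ofReal_add, mul_add, Complex.exp_add, hκs, Complex.exp_pi_div_two_mul_I]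
    have e2 : Complex.exp (-κ * ↑(x + s)) = Complex.exp (-κ * x) * -Complex.I := by
      rw [Complex.ofReal_add, mul_add, Complex.exp_add, neg_mul κ (s : ℂ), hκs,
        show -((Real.pi : ℂ) / 2 * Complex.I) = -Real.pi / 2 * Complex.I by ring,
        Complex.exp_neg_pi_div_two_mul_I]
    rw [e1, e2]
    ring
  have hsh := memLp_halfLine_comp_add hf.memLp hs0
  have n1 : ∀ x : ℝ, ‖Complex.exp (κ * x)‖ = 1 := fun x => by simp [Complex.norm_exp, hκ]
  have n2 : ∀ x : ℝ, ‖Complex.exp (-κ * x)‖ = 1 := fun x => by simp [Complex.norm_exp, hκ]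
  have hC : 2 * Complex.I * (f' 0 + κ * f 0) = 0 := by
    refine eq_zero_of_memLp_halfLine ((hf.memLp.const_mul (2 * κ * Complex.I)).add
      (hsh.const_mul (2 * κ))) fun x hx => le_of_eq ?_
    have : 2 * κ * Complex.I * f x + 2 * κ * f (x + s) =
        Complex.exp (κ * x) * (2 * Complex.I * (f' 0 + κ * f 0)) := by
      rw [shift x hx]
      linear_combination Complex.I * hf.two_mul_eq κ h' hx
    rw [Pi.add_apply, this, norm_mul (Complex.exp _), n1, one_mul]
  have hD : 2 * Complex.I * (f' 0 - κ * f 0) = 0 := by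
    refine eq_zero_of_memLp_halfLine ((hsh.const_mul (2 * κ)).sub
      (hf.memLp.const_mul (2 * κ * Complex.I))) fun x hx => le_of_eq ?_
    have : 2 * κ * f (x + s) - 2 * κ * Complex.I * f x =
        Complex.exp (-κ * x) * (2 * Complex.I * (f' 0 - κ * f 0)) := by
      rw [shift x hx]
      linear_combination -Complex.I * hf.two_mul_eq κ h' hx
    rw [Pi.sub_apply, this, norm_mul (Complex.exp _), n2, one_mul]
  have hI : (2 * Complex.I : ℂ) ≠ 0 := by simp
  have := hf.two_mul_eq κ h' hx
  rw [(mul_eq_zero.1 hC).resolve_left hI, (mul_eq_zero.1 hD).resolve_left hI] at this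
  simpa [hκ0] using this

theorem eq_zero_of_affine (hf : IsMaximalDomainFunction f f' f'')
    (h : f'' =ᵐ[halfLine] 0) {x : ℝ} (hx : 0 ≤ x) : f x = 0 := by
  have h1 : ∀ x, 0 ≤ x → f' x = f' 0 := fun x hx => by
    simpa using hf.exp_mul_sub_eq 0 (h.trans (.of_forall fun y => by simp)) hx
  have h2 : ∀ x : ℝ, 0 ≤ x → f x = f 0 + x * f' 0 := fun x hx => by
    have := eq_of_ac_of_ae_hasDerivAt_zero (g := fun x => f x - x * f' 0)
      (fun b hb => (hf.ac b hb).sub ?_) ?_ hx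
    · simp only [Complex.ofReal_zero, zero_mul, sub_zero] at this
      linear_combination this
    · exact ContDiffOn.absolutelyContinuousOnInterval
        (Complex.ofRealCLM.contDiff.mul contDiff_const).contDiffOn
    · filter_upwards [hf.ae_hasDerivAt, ae_restrict_mem measurableSet_Ici] with y h3 hy
      convert! h3.sub ((Complex.ofRealCLM.hasDerivAt (x := y)).mul_const (f' 0)) using 1
      simp [h1 y hy]
  -- The slope is the constant difference `f (x + 1) - f x`, which is in `L²`.
  have hb : f' 0 = 0 := by
    refine eq_zero_of_memLp_halfLine ((memLp_halfLine_comp_add hf.memLp zero_le_one).sub hf.memLp)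
      fun x hx => le_of_eq ?_
    rw [Pi.sub_apply, h2 x hx, h2 (x + 1) (by linarith)]
    push_cast
    ring_nf
  have ha : f 0 = 0 := eq_zero_of_memLp_halfLine hf.memLp fun x hx => by simp [h2 x hx, hb]
  simp [h2 x hx, ha, hb]

theorem eq_zero_of_nonneg (hf : IsMaximalDomainFunction f f' f'') {μ : ℝ} (hμ : 0 ≤ μ)
    (h : f'' =ᵐ[halfLine] fun x => -(μ : ℂ) * f x) {x : ℝ} (hx : 0 ≤ x) : f x = 0 := by
  rcases hμ.eq_or_lt with rfl | hμ
  · exact hf.eq_zero_of_affine (h.trans (.of_forall fun y => by simp)) hx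
  · refine hf.eq_zero_of_oscillating (Real.sqrt_pos.2 hμ) ?_ hx
    rwa [← Complex.ofReal_pow, Real.sq_sqrt hμ.le]

end IsMaximalDomainFunction

end StarGraph

/-! ### Perron–Frobenius for Hermitian matrices with positive entries. -/

section

open scoped Matrix ComplexOrder

namespace Matrix

variable {E : Type*} [Fintype E] [DecidableEq E]

theorem IsHermitian.exists_isGreatest_eigenvalue [Nonempty E] {R : Matrix E E ℂ}
    (hR : R.IsHermitian) :
    ∃ r : ℝ, (∃ c : E → ℂ, c ≠ 0 ∧ R *ᵥ c = (r : ℂ) • c) ∧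
      ((r : ℂ) • (1 : Matrix E E ℂ) - R).PosSemidef := by
  obtain ⟨i, hi⟩ := Finite.exists_max hR.eigenvalues
  refine ⟨hR.eigenvalues i, ⟨hR.eigenvectorBasis i, ?_, ?_⟩, ?_⟩
  · intro h
    exact hR.eigenvectorBasis.orthonormal.ne_zero i (by ext j; exact congrFun h j)
  · rw [hR.mulVec_eigenvectorBasis i]
    ext j
    simp
  · have hH : ((hR.eigenvalues i : ℂ) • (1 : Matrix E E ℂ) - R).IsHermitian := by
      refine IsHermitian.sub ?_ hR
      simp [IsHermitian, conjTranspose_smul]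
    rw [posSemidef_iff_isHermitian_and_spectrum_nonneg]
    refine ⟨hH, ?_⟩
    have : (hR.eigenvalues i : ℂ) • (1 : Matrix E E ℂ) = algebraMap ℂ _ (hR.eigenvalues i : ℂ) := by
      rw [Algebra.algebraMap_eq_smul_one]
    rw [this, ← spectrum.singleton_sub_eq, hR.spectrum_eq_image_range]
    rintro _ ⟨a, rfl, _, ⟨_, ⟨j, rfl⟩, rfl⟩, rfl⟩
    have := hi j
    simp only [Set.mem_ofPred_eq, sub_nonneg]
    exact Complex.real_le_real.2 this

/-- Any eigenvector for the largest eigenvalue of a Hermitian matrix with positive entries has no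
vanishing entry. -/
theorem PosSemidef.apply_ne_zero_of_mulVec_eq {R : Matrix E E ℂ} {r : ℝ}
    (hr : ((r : ℂ) • (1 : Matrix E E ℂ) - R).PosSemidef) (hpos : ∀ e e', 0 < R e e') {c : E → ℂ} (hc : c ≠ 0)
    (h : R *ᵥ c = (r : ℂ) • c) (e : E) : c e ≠ 0 := by
  set a : E → ℂ := fun e => (‖c e‖ : ℂ) with ha
  -- Replacing `c` by its entrywise modulus `a` keeps the norm and cannot lower the quadratic form
  -- of `R`. So the positive semidefinite form of `r - R` is `≤ 0` at `a`, which puts `a` in its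
  -- kernel.
  have h1 : ((r : ℂ) • (1 : Matrix E E ℂ) - R) *ᵥ a = 0 := by
    rw [← hr.dotProduct_mulVec_zero_iff]
    refine le_antisymm ?_ (hr.dotProduct_mulVec_nonneg a)
    have hR : ∀ e e', R e e' = (‖R e e'‖ : ℂ) := fun e e' => by
      exact (Complex.norm_of_nonneg' (hpos e e').le).symm
    have e1 : star c ⬝ᵥ (R *ᵥ c) = r * ∑ e, (‖c e‖ : ℂ) ^ 2 := by
      rw [h]
      simp [dotProduct, Finset.mul_sum, mul_left_comm _ (r : ℂ), ← Complex.conj_mul']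
    have e2 : star a ⬝ᵥ (R *ᵥ a) = ((∑ e, ∑ e', ‖c e‖ * (‖R e e'‖ * ‖c e'‖) : ℝ) : ℂ) := by
      simp only [dotProduct, mulVec, Finset.mul_sum, ha, Pi.star_apply]
      push_cast
      simp_rw [← hR]
      simp
    have e3 : ‖star c ⬝ᵥ (R *ᵥ c)‖ ≤ ∑ e, ∑ e', ‖c e‖ * (‖R e e'‖ * ‖c e'‖) := by
      simp only [dotProduct, mulVec, Finset.mul_sum]
      refine (norm_sum_le _ _).trans (Finset.sum_le_sum fun e _ => (norm_sum_le _ _).trans ?_)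
      simp
    have e4 : star a ⬝ᵥ (((r : ℂ) • (1 : Matrix E E ℂ) - R) *ᵥ a) =
        ((r * ∑ e, ‖c e‖ ^ 2 - ∑ e, ∑ e', ‖c e‖ * (‖R e e'‖ * ‖c e'‖) : ℝ) : ℂ) := by
      rw [sub_mulVec, dotProduct_sub, e2, smul_mulVec, one_mulVec, dotProduct_smul]
      simp [dotProduct, ha, pow_two]
    rw [e4]
    rw [e1] at e3
    have e5 : r * ∑ e, ‖c e‖ ^ 2 ≤ ‖(r : ℂ) * ∑ e, (‖c e‖ : ℂ) ^ 2‖ := by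
      refine (le_abs_self _).trans (le_of_eq ?_)
      rw [← Real.norm_eq_abs, ← Complex.norm_real]
      push_cast
      rfl
    have : r * ∑ e, ‖c e‖ ^ 2 - ∑ e, ∑ e', ‖c e‖ * (‖R e e'‖ * ‖c e'‖) ≤ 0 := by linarith
    exact_mod_cast this
  obtain ⟨e₀, he₀⟩ := Function.ne_iff.1 hc
  have h2 : (r : ℂ) * a e = ∑ e', R e e' * a e' := by
    have := congrFun h1 e
    rw [sub_mulVec, smul_mulVec, one_mulVec] at this
    simpa [mulVec, dotProduct, sub_eq_zero] using this
  -- One nonzero entry of `a` makes every entry of `R a = r a` positive.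
  have h3 : 0 < ∑ e', R e e' * a e' := by
    refine Finset.sum_pos' (fun e' _ => mul_nonneg (hpos e e').le ?_) ⟨e₀, Finset.mem_univ _, ?_⟩
    · simp [ha]
    · exact mul_pos (hpos e e₀) (by simpa [ha] using he₀)
  intro h0
  rw [← h2] at h3
  simp [ha, h0] at h3

theorem PosSemidef.le_of_mulVec_eq {R : Matrix E E ℂ} {r s : ℝ}
    (hr : ((r : ℂ) • (1 : Matrix E E ℂ) - R).PosSemidef) {c : E → ℂ} (hc : c ≠ 0)
    (h : R *ᵥ c = (s : ℂ) • c) : s ≤ r := by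
  have h1 := hr.dotProduct_mulVec_nonneg c
  rw [sub_mulVec, smul_mulVec, one_mulVec, h, ← sub_smul, dotProduct_smul, smul_eq_mul] at h1
  have h2 : 0 < star c ⬝ᵥ c := dotProduct_star_self_pos_iff.2 hc
  have h3 : (0 : ℂ) ≤ ((r - s : ℝ) : ℂ) := by
    push_cast
    exact le_of_mul_le_mul_right (by simpa using h1) h2
  exact sub_nonneg.1 (Complex.zero_le_real.1 h3)

end Matrix

/-! ### The boundary condition as an eigenvalue problem for `R`. -/

namespace StarGraph

variable {E : Type*} [Fintype E] [DecidableEq E]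

/-- For `κ` with `𝔖(iκ; M)` defined, `M = {(χ₁, χ₂) | χ₁ = R (χ₂ + κ χ₁)}` with
`R = (2κ)⁻¹ (1 + 𝔖(iκ; M))`. -/
theorem IsScatteringMatrix.mem_iff {κ : ℝ} (hκ : 0 < κ) {M : Submodule ℂ (BoundarySpace E)}
    {S : Matrix E E ℂ} (hS : IsScatteringMatrix (Complex.I * κ) M S) (x : BoundarySpace E) :
    x ∈ M ↔ x.1 = ((2 * κ : ℂ)⁻¹ • (1 + S)) *ᵥ (x.2 + (κ : ℂ) • x.1) := by
  obtain ⟨A, B, rfl, hU, rfl⟩ := hS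
  have hI : Complex.I * (Complex.I * (κ : ℂ)) = -κ := by
    rw [← mul_assoc, Complex.I_mul_I, neg_one_mul]
  rw [hI] at hU ⊢
  set U := A + (-κ : ℂ) • B with hUdef
  have hdet : IsUnit U.det := (Matrix.isUnit_iff_isUnit_det _).1 hU
  have hκ' : (2 * κ : ℂ) ≠ 0 := by simpa using hκ.ne'
  -- With `U = A - κ B` one has `A + κ B = U + 2κ B`, so the matrix collapses to `-U⁻¹ B`.
  have hR : (2 * κ : ℂ)⁻¹ • (1 + -(U⁻¹ * (A - (-κ : ℂ) • B))) = -(U⁻¹ * B) := by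
    have : A - (-κ : ℂ) • B = U + (2 * κ : ℂ) • B := by rw [hUdef]; module
    rw [this, mul_add, Matrix.nonsing_inv_mul _ hdet, Matrix.mul_smul, neg_add,
      add_neg_cancel_left, ← smul_neg, inv_smul_smul₀ hκ']
  rw [hR, kerSubspace, LinearMap.mem_ker]
  simp only [LinearMap.coprod_apply, Matrix.mulVecLin_apply]
  have hA : A = U + (κ : ℂ) • B := by rw [hUdef]; module
  have key : A *ᵥ x.1 + B *ᵥ x.2 = U *ᵥ (x.1 - (-(U⁻¹ * B)) *ᵥ (x.2 + (κ : ℂ) • x.1)) := by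
    rw [Matrix.mulVec_sub, Matrix.mulVec_mulVec, mul_neg, Matrix.mul_nonsing_inv_cancel_left _ _ hdet,
      hA, Matrix.add_mulVec, Matrix.mulVec_add, Matrix.mulVec_smul, Matrix.smul_mulVec,
      Matrix.neg_mulVec, Matrix.neg_mulVec]
    module
  rw [key, ← sub_eq_zero (a := x.1)]
  constructor
  · intro h
    have := congrArg (U⁻¹ *ᵥ ·) h
    simpa [Matrix.mulVec_mulVec, Matrix.nonsing_inv_mul _ hdet] using this
  · intro h
    rw [h, Matrix.mulVec_zero]

/-- `M` contains every `(R y, y - κ R y)`. As `κ` is real, the `κ`-terms of `omega` cancel on two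
such vectors, leaving `⟨R y, z⟩ - ⟨y, R z⟩ = 0`. -/
theorem IsIsotropic.isHermitian {M : Submodule ℂ (BoundarySpace E)} (hM : IsIsotropic M) {κ : ℝ}
    {R : Matrix E E ℂ} (hR : ∀ x, x ∈ M ↔ x.1 = R *ᵥ (x.2 + (κ : ℂ) • x.1)) : R.IsHermitian := by
  have hmem : ∀ y : E → ℂ, ((R *ᵥ y, y - (κ : ℂ) • R *ᵥ y) : BoundarySpace E) ∈ M := fun y => by
    rw [hR]; simp
  have h1 : ∀ y z : E → ℂ, star (R *ᵥ y) ⬝ᵥ z = star y ⬝ᵥ (R *ᵥ z) := fun y z => by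
    have := hM _ (hmem y) _ (hmem z)
    simp only [omega, star_sub, star_smul, sub_dotProduct, dotProduct_sub, dotProduct_smul,
      smul_dotProduct, Complex.star_def, Complex.conj_ofReal, smul_eq_mul] at this
    linear_combination this
  ext i j
  have := h1 (Pi.single i 1) (Pi.single j 1)
  simpa [Matrix.mulVec_single_one, ← Pi.single_star] using this

/-- Among the `κ` for which some nonzero `(c, -κ c)` lies in `M`, there is a largest one, and for it
`c` is unique up to a scalar. -/
theorem exists_isGreatest_boundary {M : Submodule ℂ (BoundarySpace E)}
    (hM : IsMaximalIsotropic M) (hpos : IsStrictlyPositiveSubspace M)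
    (hex : ∃ κ : ℝ, 0 < κ ∧ ∃ c : E → ℂ, c ≠ 0 ∧ (c, -(κ : ℂ) • c) ∈ M) :
    ∃ κ : ℝ, 0 < κ ∧
      (∀ κ' : ℝ, ∀ c : E → ℂ, c ≠ 0 → (c, -(κ' : ℂ) • c) ∈ M → κ' ≤ κ) ∧
      ∃ c : E → ℂ, c ≠ 0 ∧ (c, -(κ : ℂ) • c) ∈ M ∧
        ∀ d : E → ℂ, (d, -(κ : ℂ) • d) ∈ M → ∃ a : ℂ, d = a • c := by
  obtain ⟨κ₀, -, h₀⟩ := hpos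
  have hK₀ : κ₀ ≤ max κ₀ 1 := le_max_left _ _
  have hK : 0 < max κ₀ 1 := lt_of_lt_of_le one_pos (le_max_right _ _)
  generalize max κ₀ 1 = K at hK₀ hK
  obtain ⟨κ₁, hκ₁, c₁, hc₁, hc₁M⟩ := hex
  have : Nonempty E := ⟨(Function.ne_iff.1 hc₁).choose⟩
  obtain ⟨S, hS, hSpos⟩ := h₀ K hK₀
  have hR := hS.mem_iff hK
  have hRpos : ∀ e e', 0 < ((2 * K : ℂ)⁻¹ • (1 + S)) e e' := fun e e' => by
    obtain ⟨h1, h2⟩ := hSpos e e'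
    rw [Matrix.smul_apply, smul_eq_mul]
    refine mul_pos ?_ (Complex.pos_iff.2 ⟨h1, h2.symm⟩)
    have : (0 : ℝ) < (2 * K)⁻¹ := by positivity
    exact_mod_cast this
  generalize (2 * K : ℂ)⁻¹ • (1 + S) = R at hR hRpos
  have hH := hM.prop.isHermitian hR
  obtain ⟨r, ⟨c, hc, hrc⟩, hr⟩ := hH.exists_isGreatest_eigenvalue
  have hr0 : 0 < r := by
    have e := Classical.arbitrary E
    have h1 : R e e ≤ r := by simpa using hr.diag_nonneg (i := e)
    exact Complex.zero_lt_real.1 ((hRpos e e).trans_le h1)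
  have hiff : ∀ (κ : ℝ) (d : E → ℂ),
      (d, -(κ : ℂ) • d) ∈ M ↔ d = ((K - κ : ℝ) : ℂ) • R *ᵥ d := fun κ d => by
    rw [hR, ← Matrix.mulVec_smul]
    have : -(κ : ℂ) • d + (K : ℂ) • d = ((K - κ : ℝ) : ℂ) • d := by push_cast; module
    rw [this]
  -- For `κ ≥ K` the description of `M` by `𝔖(iκ; M)` itself sends `(d, -κ d)` to `d = R_κ 0 = 0`.
  have hlt : ∀ (κ : ℝ) (d : E → ℂ), d ≠ 0 → (d, -(κ : ℂ) • d) ∈ M → κ < K := by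
    intro κ d hd hdM
    by_contra! hle
    obtain ⟨S', hS', -⟩ := h₀ κ (hK₀.trans hle)
    have := (hS'.mem_iff (hK.trans_le hle) _).1 hdM
    simp [hd] at this
  have hle : ∀ (κ : ℝ) (d : E → ℂ), d ≠ 0 → (d, -(κ : ℂ) • d) ∈ M → κ ≤ K - r⁻¹ := by
    intro κ d hd hdM
    have h1 : 0 < K - κ := sub_pos.2 (hlt κ d hd hdM)
    have h2 : R *ᵥ d = (((K - κ)⁻¹ : ℝ) : ℂ) • d := by
      have h3 : ((K - κ : ℝ) : ℂ) ≠ 0 := Complex.ofReal_ne_zero.2 h1.ne'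
      rw [Complex.ofReal_inv, eq_inv_smul_iff₀ h3]
      exact ((hiff κ d).1 hdM).symm
    have h3 := hr.le_of_mulVec_eq hd h2
    have := inv_anti₀ (inv_pos.2 h1) h3
    rw [inv_inv] at this
    linarith
  have hr' : (r : ℂ) ≠ 0 := Complex.ofReal_ne_zero.2 hr0.ne'
  have heig : ∀ d : E → ℂ, (d, -((K - r⁻¹ : ℝ) : ℂ) • d) ∈ M ↔ R *ᵥ d = (r : ℂ) • d := fun d => by
    rw [hiff, sub_sub_cancel, Complex.ofReal_inv, eq_inv_smul_iff₀ hr', eq_comm]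
  -- The maximum `K - 1/r` is positive because it dominates the given `κ₁ > 0`.
  refine ⟨K - r⁻¹, hκ₁.trans_le (hle κ₁ c₁ hc₁ hc₁M), hle, c, hc, (heig c).2 hrc,
    fun d hd => ?_⟩
  have hd := (heig d).1 hd
  obtain ⟨e, he⟩ := Function.ne_iff.1 hc
  -- This multiple of `c` cancels the entry `e` of `d`. A nonzero difference would be a top
  -- eigenvector with a vanishing entry.
  refine ⟨d e / c e, sub_eq_zero.1 ?_⟩
  by_contra hne
  refine hr.apply_ne_zero_of_mulVec_eq hRpos hne ?_ e ?_
  · rw [Matrix.mulVec_sub, Matrix.mulVec_smul, hrc, hd]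
    module
  · simp [div_mul_cancel₀ _ he]

end StarGraph

end

/-! ### From eigenfunctions to boundary vectors. -/

namespace StarGraph

variable {E : Type*} [Fintype E]

theorem mem_eigenspace_neg_laplacian {M : Submodule ℂ (BoundarySpace E)} {z : ℂ}
    {ψ : HilbertSpace E} :
    ψ ∈ eigenspace (-laplacian M) z ↔ (ψ, -z • ψ) ∈ laplacianGraph M := by
  rw [← graph_laplacian, LinearPMap.mem_graph_iff, eigenspace, Submodule.mem_map]
  constructor
  · rintro ⟨x, hx, rfl⟩
    refine ⟨x, rfl, ?_⟩
    have h : -(laplacian M) x - z • (x : HilbertSpace E) = 0 := hx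
    change (laplacian M) x = -z • (x : HilbertSpace E)
    rw [neg_smul, ← sub_eq_zero.1 h, neg_neg]
  · rintro ⟨x, rfl, hx⟩
    refine ⟨x, ?_, rfl⟩
    change -(laplacian M) x - z • (x : HilbertSpace E) = 0
    rw [hx]
    simp

/-- The vector `{c_e e^{-κ x}}_e` of the Hilbert space. -/
noncomputable def expVector (E : Type*) [Fintype E] {κ : ℝ} (hκ : 0 < κ) : (E → ℂ) →ₗ[ℂ] HilbertSpace E where
  toFun c := WithLp.toLp 2 fun e => c e • (memLp_exp_neg hκ).toLp _
  map_add' c d := by ext1 e; exact add_smul _ _ _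
  map_smul' a c := by ext1 e; exact mul_smul _ _ _

theorem coeFn_expVector {κ : ℝ} (hκ : 0 < κ) (c : E → ℂ) (e : E) :
    expVector E hκ c e =ᵐ[halfLine] fun x => c e * Complex.exp (-κ * x) := by
  refine (Lp.coeFn_smul (c e) ((memLp_exp_neg hκ).toLp _)).trans ?_
  filter_upwards [(memLp_exp_neg hκ).coeFn_toLp] with x hx
  rw [Pi.smul_apply, hx, smul_eq_mul]

theorem expVector_injective {κ : ℝ} (hκ : 0 < κ) : Function.Injective (expVector E hκ) := by
  rw [injective_iff_map_eq_zero]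
  intro c hc
  ext e
  have h1 : (c e • (memLp_exp_neg hκ).toLp _ : Lp ℂ 2 halfLine) = 0 :=
    congrArg (fun ψ : HilbertSpace E => ψ e) hc
  refine (smul_eq_zero.1 h1).resolve_right fun h => one_ne_zero (α := ℂ) ?_
  have h2 : (fun x : ℝ => Complex.exp (-κ * x)) =ᵐ[halfLine] 0 :=
    (memLp_exp_neg hκ).coeFn_toLp.symm.trans (by rw [h]; exact Lp.coeFn_zero _ _ _)
  have h3 : halfLine ≠ 0 := by simp
  have : (ae halfLine).NeBot := ae_neBot.2 h3
  obtain ⟨x, hx⟩ := h2.exists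
  exact absurd hx (Complex.exp_ne_zero _)

theorem exists_of_mem_eigenspace {M : Submodule ℂ (BoundarySpace E)} {μ : ℂ} {ψ : HilbertSpace E}
    (h : ψ ∈ eigenspace (-laplacian M) μ) : ∃ f f' f'' : E → ℝ → ℂ,
      (∀ e, IsMaximalDomainFunction (f e) (f' e) (f'' e)) ∧ (∀ e, ψ e =ᵐ[halfLine] f e) ∧
      (∀ e, f'' e =ᵐ[halfLine] fun x => -μ * f e x) ∧
      ((fun e => f e 0, fun e => f' e 0) : BoundarySpace E) ∈ M := by
  obtain ⟨f, f', f'', hf, h1, h2, hM⟩ := mem_eigenspace_neg_laplacian.1 h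
  refine ⟨f, f', f'', hf, h1, fun e => ?_, hM⟩
  filter_upwards [h1 e, h2 e, Lp.coeFn_smul (-μ) (ψ e)] with x h3 h4 h5
  rw [← h4, ← h3]
  exact h5

theorem eigenspace_neg_laplacian_eq_bot {M : Submodule ℂ (BoundarySpace E)} {μ : ℝ} (hμ : 0 ≤ μ) :
    eigenspace (-laplacian M) (μ : ℂ) = ⊥ := by
  rw [Submodule.eq_bot_iff]
  intro ψ hψ
  obtain ⟨f, f', f'', hf, h1, h2, -⟩ := exists_of_mem_eigenspace hψ
  ext1 e
  refine Lp.ext ((h1 e).trans (.trans ?_ (Lp.coeFn_zero _ _ _).symm))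
  filter_upwards [ae_restrict_mem measurableSet_Ici] with x hx
  exact (hf e).eq_zero_of_nonneg hμ (h2 e) hx

/-- Square integrability leaves only the decaying exponential on each edge, so an eigenfunction is
determined by its values at the vertex, and its derivatives there are `-κ` times them. -/
theorem mem_eigenspace_neg_laplacian_iff_of_pos {M : Submodule ℂ (BoundarySpace E)} {κ : ℝ}
    (hκ : 0 < κ) {ψ : HilbertSpace E} :
    ψ ∈ eigenspace (-laplacian M) ((-κ ^ 2 : ℝ) : ℂ) ↔
      ∃ c : E → ℂ, (c, -(κ : ℂ) • c) ∈ M ∧ expVector E hκ c = ψ := by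
  constructor
  · intro hψ
    obtain ⟨f, f', f'', hf, h1, h2, hM⟩ := exists_of_mem_eigenspace hψ
    have key := fun e => (hf e).eq_exp_of_pos hκ (by simpa using h2 e)
    refine ⟨fun e => f e 0, ?_, ?_⟩
    · convert hM using 2
      ext e
      exact (key e).1.symm
    · ext1 e
      refine Lp.ext ((coeFn_expVector hκ _ e).trans (.trans ?_ (h1 e).symm))
      filter_upwards [ae_restrict_mem measurableSet_Ici] with x hx
      exact ((key e).2 x hx).symm
  · rintro ⟨c, hc, rfl⟩
    rw [mem_eigenspace_neg_laplacian]
    refine ⟨_, _, _, fun e => (isMaximalDomainFunction_exp hκ).smul (c e), fun e =>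
      coeFn_expVector hκ c e, fun e => ?_, ?_⟩
    · refine (Lp.coeFn_smul (-((-κ ^ 2 : ℝ) : ℂ)) (expVector E hκ c e)).trans ?_
      filter_upwards [coeFn_expVector hκ c e] with x hx
      rw [Pi.smul_apply, hx]
      simp only [Pi.smul_apply, smul_eq_mul]
      push_cast
      ring
    · convert hc using 2
      · ext e; simp
      · ext e; simp [mul_comm]

theorem isEigenvalue_neg_laplacian_iff {M : Submodule ℂ (BoundarySpace E)} {μ : ℝ} :
    IsEigenvalue (-laplacian M) (μ : ℂ) ↔
      ∃ κ : ℝ, 0 < κ ∧ μ = -κ ^ 2 ∧ ∃ c : E → ℂ, c ≠ 0 ∧ (c, -(κ : ℂ) • c) ∈ M := by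
  constructor
  · intro h
    have hμ : μ < 0 := not_le.1 fun h0 => h (eigenspace_neg_laplacian_eq_bot h0)
    have hκ : 0 < √(-μ) := Real.sqrt_pos.2 (neg_pos.2 hμ)
    have hμκ : μ = -√(-μ) ^ 2 := by rw [Real.sq_sqrt (neg_nonneg.2 hμ.le), neg_neg]
    refine ⟨√(-μ), hκ, hμκ, ?_⟩
    obtain ⟨ψ, hψ, hψ0⟩ := Submodule.exists_mem_ne_zero_of_ne_bot h
    rw [hμκ, mem_eigenspace_neg_laplacian_iff_of_pos hκ] at hψ
    obtain ⟨c, hc, rfl⟩ := hψ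
    exact ⟨c, fun h0 => hψ0 (by rw [h0, map_zero]), hc⟩
  · rintro ⟨κ, hκ, rfl, c, hc, hcM⟩ h
    have := (mem_eigenspace_neg_laplacian_iff_of_pos hκ).2 ⟨c, hcM, rfl⟩
    rw [h, Submodule.mem_bot, map_eq_zero_iff _ (expVector_injective hκ)] at this
    exact hc this

end StarGraph

theorem mainTheorem6 {E : Type*} [Fintype E] [DecidableEq E]
    (M : Submodule ℂ (StarGraph.BoundarySpace E))
    (hM : StarGraph.IsMaximalIsotropic M) (hpos : StarGraph.IsStrictlyPositiveSubspace M)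
    (hex : ∃ μ : ℝ, StarGraph.IsEigenvalue (-StarGraph.laplacian M) (μ : ℂ)) :
    ∃ lam : ℝ, lam ≤ 0 ∧
      IsLeast {μ : ℝ | StarGraph.IsEigenvalue (-StarGraph.laplacian M) (μ : ℂ)} lam ∧
      Module.finrank ℂ (StarGraph.eigenspace (-StarGraph.laplacian M) (lam : ℂ)) = 1 := by
  obtain ⟨μ, hμ⟩ := hex
  obtain ⟨κ₁, hκ₁, -, hc₁⟩ := StarGraph.isEigenvalue_neg_laplacian_iff.1 hμ
  obtain ⟨κ, hκ, hmax, c, hc, hcM, huniq⟩ :=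
    StarGraph.exists_isGreatest_boundary hM hpos ⟨κ₁, hκ₁, hc₁⟩
  refine ⟨-κ ^ 2, by nlinarith, ⟨?_, ?_⟩, ?_⟩
  · exact StarGraph.isEigenvalue_neg_laplacian_iff.2 ⟨κ, hκ, rfl, c, hc, hcM⟩
  · intro ν hν
    obtain ⟨κ', hκ', rfl, d, hd, hdM⟩ := StarGraph.isEigenvalue_neg_laplacian_iff.1 hν
    have := hmax κ' d hd hdM
    -- Both parameters are positive, so `κ' ≤ κ` reverses to `-κ² ≤ -κ'²`.
    nlinarith
  · have hmem := (StarGraph.mem_eigenspace_neg_laplacian_iff_of_pos hκ).2 ⟨c, hcM, rfl⟩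
    refine (finrank_eq_one_iff_of_nonzero' ⟨_, hmem⟩ ?_).2 ?_
    · rw [Ne, Submodule.mk_eq_zero, map_eq_zero_iff _ (StarGraph.expVector_injective hκ)]
      exact hc
    · rintro ⟨ψ, hψ⟩
      obtain ⟨d, hdM, rfl⟩ := (StarGraph.mem_eigenspace_neg_laplacian_iff_of_pos hκ).1 hψ
      obtain ⟨a, rfl⟩ := huniq d hdM
      exact ⟨a, Subtype.ext (map_smul _ a c).symm⟩
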